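/- Let $q$ be prime, $L\ge 2$ an integer coprime to $q$, $J=\varphi(L)$, $m_L$ the multiplicative order of $q$ modulo $L$, and $\mathcal J=\{j: 1\le j\le L-1,\ \gcd(j,L)=1\}$. Let $\beta\in\mathbb F_{q^{m_L}}$ be a primitive $L$-th root of unity, $V_L=[\beta^{ij}]_{0\le i,j<L}$, $\widetilde V_L=[\beta^{-ij}]_{0\le i,j<L}$, and let $C_L$ be the $L\times L$ cyclic permutation matrix (its $1$'s are in the positions $(i,\,i+1 \bmod L)$). Let $G_L\in\mathbb F_q^{J\times L}$ and $H_L\in\mathbb F_q^{L\times J}$ be of the form $G_L=U\widetilde V_L$, $H_L=V_LU'^{\mathrm T}$, where $U=[u_j]_{0\le j<L}$ and $U'=[u'_j]_{0\le j<L}$ in $\mathbb F_{q^{m_L}}^{J\times L}$ satisfy $\operatorname{rank}[u_j]_{j\in\mathcal J}=J$, $[u'_j]_{j\in\mathcal J}^{\mathrm T}=L^{-1}[u_j]_{j\in\mathcal J}^{-1}$, and ($u_j=0$ for all $j\notin\mathcal J$, or $u'_j=0$ for all $j\notin\mathcal J$). Put $\tau(x)=\prod_{0\le j<L,\ j\notin\mathcal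 J}(x-\beta^j)\in\mathbb F_q[x]$. Let $1\le k<n\le m_L$, let $\Psi$ be the $k\times n$ block matrix with blocks $C_L^{q^s l_i}$ ($0\le s<k$, $0\le i<n$), and let $\Delta:\mathbb F_q^{Jn}\to\mathbb F_q^{J\times n}$ send $[c_0\ \dots\ c_{n-1}]$ with $c_i\in\mathbb F_q^J$ to $[c_0^{\mathrm T}\ \dots\ c_{n-1}^{\mathrm T}]$. Let $$\mathcal C_1=\{\Delta(m(I_k\otimes G_L)\Psi(I_n\otimes H_L)): m\in\mathbb F_q^{Jk}\},\qquad \mathcal C_2=\{\Delta(m(I_k\otimes G_L)\Psi(I_n\otimes \tau(C_L)G_L^{\mathrm T})): m\in\mathbb F_q^{Jk}\}.$$ Suppose that $J\ne m_L$ and that $l_j=(c'j+c)\bmod L$ for $0\le j\le n-1$, where $0\le c\le L-1$ and $1\le c'\le L-1$ are constants with $\sum_{j=0}^{k-1}c'q^j$ coprime to $L$. Then both $\mathcal C_1$ and $\mathcal C_2$ are different from every $J\times n$ twisted Gabidulin code with $h=0$, that is, from every code $$\mathcal M_{\mathcal B}(\mathcal S)=\{[v_{\mathcal B}(p(\beta_0))^{\mathrm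 T}\ \dots\ v_{\mathcal B}(p(\beta_{n-1}))^{\mathrm T}]: p\in\mathcal H\},\qquad \mathcal H=\{u_0x+u_1x^q+\dots+u_{k-1}x^{q^{k-1}}+\eta u_0x^{q^k}: u_0,\dots,u_{k-1}\in\mathbb F_{q^J}\},$$ whatever the basis $\mathcal B$ of $\mathbb F_{q^J}$ over $\mathbb F_q$, the $\mathbb F_q$-linearly independent elements $\beta_0,\dots,\beta_{n-1}\in\mathbb F_{q^J}$ and the element $\eta\in\mathbb F_{q^J}$ (in particular for every $\eta$ that satisfies the usual norm condition on $\eta^{(q^J-1)/(q-1)}$ which makes these codes MRD). Here $v_{\mathcal B}(\gamma)\in\mathbb F_q^J$ is the coordinate row vector of $\gamma$ with respect to $\mathcal B$. -/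

import Mathlib

open scoped Matrix Kronecker

namespace CircShift

open Polynomial

/-- The `L × L` cyclic permutation matrix: row `i` has its single `1` in column `i + 1 mod L`. -/
def cyclicMatrix (R : Type*) [Semiring R] (L : ℕ) : Matrix (Fin L) (Fin L) R :=
  Matrix.of fun i j => if (j : ℕ) = ((i : ℕ) + 1) % L then 1 else 0

/-- The `k × n` block matrix whose block in position `(s, i)` is the `L × L` circulant matrix
`C_L ^ (q ^ s * l i)`. A row or column is indexed by its block and its place in that block. -/
def blockPsi (q L k : ℕ) {n : ℕ} (l : Fin n → ℕ) :
    Matrix (Fin k × Fin L) (Fin n × Fin L) (ZMod q) :=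
  Matrix.of fun a b => (cyclicMatrix (ZMod q) L ^ (q ^ (a.1 : ℕ) * l b.1)) a.2 b.2

/-- The map `Δ` that turns a row vector `[c_0 c_1 … c_{n-1}]`, with `n` blocks of length `J`,
into the `J × n` matrix with columns `c_0ᵀ, …, c_{n-1}ᵀ`. -/
def blocksToColumns {R : Type*} {n J : ℕ} (c : Fin n × Fin J → R) : Matrix (Fin J) (Fin n) R :=
  Matrix.of fun r i => c (i, r)

/-- The circular-shift-based rank-metric code
`{Δ(m (I_k ⊗ P) Ψ (I_n ⊗ Q)) : m ∈ 𝔽_q^{Jk}}`, where `J = φ(L)`. -/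
def circularShiftCode (q L k : ℕ) {n : ℕ} (l : Fin n → ℕ)
    (P : Matrix (Fin L.totient) (Fin L) (ZMod q)) (Q : Matrix (Fin L) (Fin L.totient) (ZMod q)) :
    Set (Matrix (Fin L.totient) (Fin n) (ZMod q)) :=
  {M | ∃ m : Fin k × Fin L.totient → ZMod q,
    M = blocksToColumns
      (m ᵥ* (((1 : Matrix (Fin k) (Fin k) (ZMod q)) ⊗ₖ P) * blockPsi q L k l *
        ((1 : Matrix (Fin n) (Fin n) (ZMod q)) ⊗ₖ Q)))}

/-- The `L × L` Vandermonde matrix with entries `β ^ (i * j)`. -/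
def vandermondeL {E : Type*} [Field E] (L : ℕ) (β : E) : Matrix (Fin L) (Fin L) E :=
  Matrix.of fun i j => β ^ ((i : ℕ) * (j : ℕ))

/-- The column indices in `0, …, L - 1` that are coprime to `L` (for `L ≥ 2` there are `φ(L)` of
them, and they lie between `1` and `L - 1`). -/
abbrev CoprimeIdx (L : ℕ) : Type := {j : Fin L // Nat.Coprime (j : ℕ) L}

/-- The columns of `U` whose index is coprime to `L`. -/
def coprimeCols {E : Type*} {J L : ℕ} (U : Matrix (Fin J) (Fin L) E) :
    Matrix (Fin J) (CoprimeIdx L) E :=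
  U.submatrix id Subtype.val

/-- `G` and `H` are matrices over `𝔽_q` obtained as `G = U Ṽ` and `H = V U'ᵀ`, where `V`, `Ṽ` are
the Vandermonde matrices of `β`, `β⁻¹`, and `U`, `U'` are `J × L` matrices over the extension
field `E` such that
* the `J × J` matrix `A` of the columns of `U` with index coprime to `L` has full rank;
* the corresponding submatrix `A'` of `U'` has `A'ᵀ = L⁻¹ A⁻¹`, that is, `A'ᵀ A = L⁻¹ I`;
* the remaining columns are all zero in `U`, or all zero in `U'`. -/
def IsGHPair {q L : ℕ} {E : Type*} [Field E] [Algebra (ZMod q) E] (β : E)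
    (G : Matrix (Fin L.totient) (Fin L) (ZMod q))
    (H : Matrix (Fin L) (Fin L.totient) (ZMod q)) : Prop :=
  ∃ U U' : Matrix (Fin L.totient) (Fin L) E,
    (coprimeCols U).rank = L.totient ∧
    (coprimeCols U')ᵀ * coprimeCols U = ((L : E)⁻¹) • (1 : Matrix (CoprimeIdx L) (CoprimeIdx L) E) ∧
    ((∀ r (j : Fin L), ¬ Nat.Coprime (j : ℕ) L → U r j = 0) ∨
      (∀ r (j : Fin L), ¬ Nat.Coprime (j : ℕ) L → U' r j = 0)) ∧
    G.map (algebraMap (ZMod q) E) = U * vandermondeL L β⁻¹ ∧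
    H.map (algebraMap (ZMod q) E) = vandermondeL L β * U'ᵀ

/-- The polynomial `τ` over `𝔽_q` whose roots are the `L`-th roots of unity that are not primitive.
The lemma `tau_map` below shows `τ(x) = ∏ (x - β^j)` over all `0 ≤ j < L` not coprime to `L`. -/
noncomputable def tau (q L : ℕ) : (ZMod q)[X] :=
  ∏ d ∈ L.properDivisors, cyclotomic d (ZMod q)

theorem tau_map {q L : ℕ} {E : Type*} [Field E] [Algebra (ZMod q) E] (hL : 0 < L) {β : E}
    (hβ : IsPrimitiveRoot β L) :
    (tau q L).map (algebraMap (ZMod q) E) =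
      ∏ j ∈ (Finset.range L).filter (fun j => ¬ Nat.Coprime j L), (X - C (β ^ j)) := by
  have : NeZero L := ⟨hL.ne'⟩
  have h1 : ∏ j ∈ Finset.range L, (X - C (β ^ j)) = (X ^ L - 1 : E[X]) := by
    have := X_pow_sub_C_eq_prod hβ hL (one_pow L : (1 : E) ^ L = 1)
    simpa using this.symm
  have h2 : ∏ j ∈ (Finset.range L).filter (fun j => Nat.Coprime j L), (X - C (β ^ j))
      = cyclotomic L E := by
    rw [cyclotomic_eq_prod_X_sub_primitiveRoots hβ]
    refine Finset.prod_bij (fun j _ => β ^ j) ?_ ?_ ?_ ?_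
    · intro j hj
      rw [Finset.mem_filter] at hj
      exact (mem_primitiveRoots hL).2 (hβ.pow_of_coprime j hj.2)
    · intro a ha b hb hab
      simp only [Finset.mem_filter, Finset.mem_range] at ha hb
      exact hβ.pow_inj ha.1 hb.1 hab
    · intro z hz
      obtain ⟨i, hi, hc, rfl⟩ := hβ.isPrimitiveRoot_iff.1 ((mem_primitiveRoots hL).1 hz)
      exact ⟨i, Finset.mem_filter.2 ⟨Finset.mem_range.2 hi, hc⟩, rfl⟩
    · intro j _
      rfl
  have h3 : (∏ d ∈ L.properDivisors, cyclotomic d E) * cyclotomic L E = X ^ L - 1 := by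
    rw [← prod_cyclotomic_eq_X_pow_sub_one hL, ← Nat.cons_self_properDivisors hL.ne',
      Finset.prod_cons, mul_comm]
  have h4 := Finset.prod_filter_mul_prod_filter_not (Finset.range L)
    (fun j => Nat.Coprime j L) (fun j => (X - C (β ^ j) : E[X]))
  rw [h1, h2, ← h3, mul_comm] at h4
  have h5 := mul_right_cancel₀ (cyclotomic_ne_zero L E) h4
  rw [h5, tau, Polynomial.map_prod]
  simp [map_cyclotomic]

/-- The circular-shift-based code `𝒞₁`: the choice `P = G_L`, `Q = H_L`. -/
def codeC1 (q L k : ℕ) {n : ℕ} (l : Fin n → ℕ)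
    (G : Matrix (Fin L.totient) (Fin L) (ZMod q)) (H : Matrix (Fin L) (Fin L.totient) (ZMod q)) :
    Set (Matrix (Fin L.totient) (Fin n) (ZMod q)) :=
  circularShiftCode q L k l G H

/-- The circular-shift-based code `𝒞₂`: the choice `P = G_L`, `Q = τ(C_L) G_Lᵀ`. -/
noncomputable def codeC2 (q L k : ℕ) {n : ℕ} (l : Fin n → ℕ)
    (G : Matrix (Fin L.totient) (Fin L) (ZMod q)) :
    Set (Matrix (Fin L.totient) (Fin n) (ZMod q)) :=
  circularShiftCode q L k l G (aeval (cyclicMatrix (ZMod q) L) (tau q L) * Gᵀ)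

/-- The `q`-linearized polynomials
`u_0 x + u_1 x^q + … + u_{k-1} x^(q^(k-1)) + η u_0^(q^h) x^(q^k)` with `u_0, …, u_{k-1} ∈ K`. -/
def twistedPolys {K : Type*} [Field K] (q : ℕ) {k : ℕ} (hk : 0 < k) (h : ℕ) (η : K) : Set K[X] :=
  {p | ∃ u : Fin k → K,
    p = ∑ s : Fin k, C (u s) * X ^ q ^ (s : ℕ) + C (η * u ⟨0, hk⟩ ^ q ^ h) * X ^ q ^ k}

/-- The twisted Gabidulin (vector) code with evaluation points `b_0, …, b_{n-1}`. -/
def twistedGabidulin {K : Type*} [Field K] (q : ℕ) {k n : ℕ} (hk : 0 < k) (h : ℕ) (η : K)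
    (b : Fin n → K) : Set (Fin n → K) :=
  {v | ∃ p ∈ twistedPolys q hk h η, v = fun j => p.eval (b j)}

/-- The matrix code induced from a vector code `S` by a basis `B` of `K` over `𝔽_q`: column `j` of
`B.toMatrix v` is the coordinate vector of `v j` with respect to `B`. -/
def matrixCode {q N n : ℕ} {K : Type*} [Field K] [Algebra (ZMod q) K]
    (B : Module.Basis (Fin N) (ZMod q) K) (S : Set (Fin n → K)) :
    Set (Matrix (Fin N) (Fin n) (ZMod q)) :=
  {M | ∃ v ∈ S, M = B.toMatrix v}

end CircShift

namespace CircShift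

open Polynomial

/-! The obstruction is the left stabilizer of the code. For h = 0 the polynomials of ℋ are closed
under scaling by K = 𝔽_{q^J}, so the multiplication matrices of K map a twisted Gabidulin code into
itself. A circular-shift code admits no such action of K when J > m_L, and J ≠ m_L forces J > m_L
because m_L ≤ φ(L).

Over E the Vandermonde matrices diagonalize C_L, so for both codes P C_L^t Q = A diag(β^{jt}) W,
with j running over the indices coprime to L and A, W invertible. Let z be the column j = 1 of Z =
W⁻¹. Pairing z with the columns of a codeword isolates the index 1 and leaves a vector in the span S
of the (β^{q^s l_i})_i, s < k. If X stabilizes the code, then zX also sends every codeword into S. A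
nonzero coordinate of W(zX)ᵀ at some j ≠ 1 would contribute vectors (β^{j q^s l_i})_i, and for a
suitable s these lie outside S (`exists_mul_pow_ne_pow`, `exists_functional`). Hence zX = y z
(`exists_eigenvalue`).

The eigenvalue y is additive and multiplicative in X, so K embeds into E over 𝔽_q and J ≤ m_L
(`totient_le_finrank_of_stabilizer`), a contradiction. -/

theorem cyclicMatrix_map {R S : Type*} [Semiring R] [Semiring S] (f : R →+* S) (L : ℕ) :
    (cyclicMatrix R L).map f = cyclicMatrix S L := by
  ext i j
  simp only [cyclicMatrix, Matrix.map_apply, Matrix.of_apply]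
  split_ifs <;> simp

/-! ### Diagonalization of the cyclic matrix by Vandermonde matrices. -/

section Diagonalization

variable {E : Type*} [Field E] {L : ℕ} {β : E}

/-- Shifting the geometric sequence (β^{ij})_i by one multiplies it by β^j; the wrap-around is
consistent because β^L = 1. -/
theorem cyclicMatrix_mul_vandermondeL (hL : 0 < L) (hβ : β ^ L = 1) :
    cyclicMatrix E L * vandermondeL L β =
      vandermondeL L β * Matrix.diagonal (fun j : Fin L => β ^ (j : ℕ)) := by
  ext i j
  rw [Matrix.mul_diagonal, Matrix.mul_apply,
    Finset.sum_eq_single (⟨((i : ℕ) + 1) % L, Nat.mod_lt _ hL⟩ : Fin L)]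
  · simp only [cyclicMatrix, vandermondeL, Matrix.of_apply, if_true, one_mul]
    rw [pow_mul, ← pow_eq_pow_mod _ hβ, ← pow_mul, ← pow_add, Nat.add_mul, one_mul]
  · intro b _ hb
    simp only [cyclicMatrix, Matrix.of_apply]
    rw [if_neg (fun h => hb (Fin.ext h)), zero_mul]
  · simp

theorem aeval_cyclicMatrix_mul_vandermondeL (hL : 0 < L) (hβ : β ^ L = 1) (p : E[X]) :
    aeval (cyclicMatrix E L) p * vandermondeL L β =
      vandermondeL L β * Matrix.diagonal (fun j : Fin L => p.eval (β ^ (j : ℕ))) := by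
  induction p using Polynomial.induction_on' with
  | add p q hp hq =>
    rw [map_add, add_mul, hp, hq, ← mul_add, Matrix.diagonal_add]
    simp
  | monomial t a =>
    have h : ∀ t : ℕ, cyclicMatrix E L ^ t * vandermondeL L β =
        vandermondeL L β * Matrix.diagonal (fun j : Fin L => (β ^ (j : ℕ)) ^ t) := by
      intro t
      induction t with
      | zero => simp
      | succ t ih =>
        rw [pow_succ, mul_assoc, cyclicMatrix_mul_vandermondeL hL hβ, ← mul_assoc, ih, mul_assoc,
          Matrix.diagonal_mul_diagonal]
        simp only [pow_succ]
    rw [aeval_monomial, mul_assoc, h]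
    ext i j
    simp only [Matrix.mul_diagonal, eval_monomial, Matrix.algebraMap_eq_diagonal,
      Matrix.diagonal_mul]
    simp only [Pi.algebraMap_apply, Algebra.algebraMap_self, RingHom.id_apply]
    ring

theorem vandermondeL_inv_mul_vandermondeL (hβ : IsPrimitiveRoot β L) :
    vandermondeL L β⁻¹ * vandermondeL L β = (L : E) • (1 : Matrix (Fin L) (Fin L) E) := by
  ext i j
  have hL : 0 < L := i.pos
  have hβ0 : β ≠ 0 := hβ.ne_zero hL.ne'
  simp only [vandermondeL, Matrix.mul_apply, Matrix.of_apply, Matrix.smul_apply, Matrix.one_apply,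
    smul_eq_mul]
  have hterm : ∀ a : Fin L, β⁻¹ ^ ((i : ℕ) * (a : ℕ)) * β ^ ((a : ℕ) * (j : ℕ)) =
      (β⁻¹ ^ (i : ℕ) * β ^ (j : ℕ)) ^ (a : ℕ) := by
    intro a
    rw [mul_pow, ← pow_mul, ← pow_mul, mul_comm (a : ℕ)]
  rw [Finset.sum_congr rfl (fun a _ => hterm a),
    Fin.sum_univ_eq_sum_range (fun a => (β⁻¹ ^ (i : ℕ) * β ^ (j : ℕ)) ^ a) L]
  split_ifs with h
  · subst h
    simp [inv_mul_cancel₀ (pow_ne_zero (i : ℕ) hβ0)]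
  · have hne : β⁻¹ ^ (i : ℕ) * β ^ (j : ℕ) ≠ 1 := by
      intro h1
      rw [inv_pow, inv_mul_eq_one₀ (pow_ne_zero _ hβ0)] at h1
      exact h (Fin.ext (hβ.pow_inj i.2 j.2 h1))
    have h0 : (β⁻¹ ^ (i : ℕ) * β ^ (j : ℕ)) ^ L = 1 := by
      rw [mul_pow, ← pow_mul, ← pow_mul, mul_comm, mul_comm _ L, mul_comm _ L, pow_mul, pow_mul,
        inv_pow, hβ.pow_eq_one]
      simp
    rw [geom_sum_eq hne, h0]
    simp

/-- The matrix of `β⁻¹` is that of `β` with the columns in the order `j ↦ -j`. -/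
theorem vandermondeL_inv [NeZero L] (hβ : IsPrimitiveRoot β L) :
    vandermondeL L β⁻¹ = (vandermondeL L β).submatrix id (fun j : Fin L => -j) := by
  ext i j
  simp only [vandermondeL, Matrix.of_apply, Matrix.submatrix_apply, id]
  have hβ0 : β ≠ 0 := hβ.ne_zero (NeZero.ne L)
  have h : β ^ ((-j : Fin L) : ℕ) = β⁻¹ ^ (j : ℕ) := by
    rw [Fin.val_neg', ← pow_eq_pow_mod _ hβ.pow_eq_one, inv_pow]
    refine eq_inv_of_mul_eq_one_left ?_
    rw [← pow_add, Nat.sub_add_cancel j.2.le, hβ.pow_eq_one]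
  rw [mul_comm (i : ℕ), mul_comm (i : ℕ), pow_mul, pow_mul, h]

/-- The product of `U Ṽ`, a polynomial in the cyclic matrix and `V Wᵀ`, in diagonalized form. -/
theorem mul_aeval_cyclicMatrix_mul {J : Type*} (hL : 0 < L) (hβ : IsPrimitiveRoot β L)
    (U W : Matrix J (Fin L) E) (p : E[X]) (r r' : J) :
    (U * vandermondeL L β⁻¹ * aeval (cyclicMatrix E L) p * (vandermondeL L β * Wᵀ)) r r' =
      ∑ j : Fin L, U r j * p.eval (β ^ (j : ℕ)) * ((L : E) * W r' j) := by
  have : U * vandermondeL L β⁻¹ * aeval (cyclicMatrix E L) p * (vandermondeL L β * Wᵀ) =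
      (L : E) • (U * Matrix.diagonal (fun j : Fin L => p.eval (β ^ (j : ℕ))) * Wᵀ) := by
    rw [← Matrix.mul_assoc, Matrix.mul_assoc _ (aeval _ _),
      aeval_cyclicMatrix_mul_vandermondeL hL hβ.pow_eq_one, ← Matrix.mul_assoc,
      Matrix.mul_assoc U, vandermondeL_inv_mul_vandermondeL hβ]
    simp
  rw [this, Matrix.smul_apply, Matrix.mul_apply, smul_eq_mul, Finset.mul_sum]
  refine Finset.sum_congr rfl fun j _ => ?_
  rw [Matrix.mul_diagonal, Matrix.transpose_apply]
  ring

end Diagonalization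

/-! ### Separating powers of β by a linear functional. -/

section Separation

/-- The set {1, x, …, x^{k-1}} is shorter than a full cycle of x, so no multiplier except 1 maps it
into itself. -/
theorem exists_mul_pow_ne_pow {L k : ℕ} {x : ZMod L} (hk : 0 < k)
    (hkx : k < orderOf x) {j : ZMod L} (hj : j ≠ 1) :
    ∃ s < k, ∀ t < k, j * x ^ s ≠ x ^ t := by
  by_contra! h
  obtain ⟨t, htk, ht⟩ := h 0 hk
  rw [pow_zero, mul_one] at ht
  have ht0 : t ≠ 0 := by
    rintro rfl
    exact hj (by simpa using ht)
  -- Here j = x^t with 0 < t < k, so the exponent k - t is admissible and yields x^k, the first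
  -- power outside the list.
  obtain ⟨u, huk, hu⟩ := h (k - t) (by omega)
  rw [ht, ← pow_add, Nat.add_sub_cancel' htk.le] at hu
  have := pow_injOn_Iio_orderOf (Set.mem_Iio.2 hkx) (Set.mem_Iio.2 (huk.trans hkx)) hu
  omega

/-- A linear functional on `E ^ n` that vanishes on the evaluation vectors of `β ^ (q ^ t)` for
`t < k` and on no evaluation vector of another power of `β`. -/
theorem exists_functional {E : Type*} [Field E] {L : ℕ} {β : E} (hL : 0 < L)
    (hβ : IsPrimitiveRoot β L) {q k n : ℕ} (hkn : k < n) {l : Fin n → ℕ} {c c' : ℕ}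
    (hl : ∀ j : Fin n, l j = (c' * (j : ℕ) + c) % L) (hc' : Nat.Coprime L c') :
    ∃ f : Fin n → E, (∀ t < k, ∑ i, f i * β ^ (q ^ t * l i) = 0) ∧
      ∀ a : ℕ, (∀ t < k, (a : ZMod L) ≠ (q : ZMod L) ^ t) → ∑ i, f i * β ^ (a * l i) ≠ 0 := by
  -- The l_i form an arithmetic progression mod L, so pairing the coefficients of F with (β^{a
  -- l_i})_i gives F(β^{c'a}) up to a power of β. The roots of F are those with a = q^t, t < k; its
  -- degree k < n lets all coefficients fit.
  set F : E[X] := ∏ t ∈ Finset.range k, (X - C (β ^ (c' * q ^ t))) with hF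
  have hdeg : F.natDegree < n := by
    rw [hF, natDegree_prod_of_monic _ _ (fun t _ => monic_X_sub_C _)]
    simpa only [natDegree_X_sub_C, Finset.sum_const, Finset.card_range, smul_eq_mul, mul_one]
  have key : ∀ a : ℕ, ∑ i : Fin n, F.coeff i * β ^ (a * l i) =
      β ^ (a * c) * F.eval (β ^ (c' * a)) := by
    intro a
    rw [eval_eq_sum_range' hdeg, ← Fin.sum_univ_eq_sum_range
      (fun i => F.coeff i * (β ^ (c' * a)) ^ i), Finset.mul_sum]
    refine Finset.sum_congr rfl fun i _ => ?_
    have : β ^ (a * l i) = β ^ (a * (c' * i + c)) := by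
      rw [hl, mul_comm a, pow_mul, ← pow_eq_pow_mod _ hβ.pow_eq_one, ← pow_mul, mul_comm a]
    rw [this, ← pow_mul]
    ring
  refine ⟨fun i => F.coeff i, fun t ht => ?_, fun a ha => ?_⟩
  · rw [key, hF, eval_prod, Finset.prod_eq_zero (Finset.mem_range.2 ht) (by simp), mul_zero]
  · rw [key, hF, eval_prod]
    refine mul_ne_zero (pow_ne_zero _ (hβ.ne_zero hL.ne')) (Finset.prod_ne_zero_iff.2 ?_)
    intro t ht h
    rw [eval_sub, eval_X, eval_C, sub_eq_zero, pow_eq_pow_mod _ hβ.pow_eq_one,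
      pow_eq_pow_mod (c' * q ^ t) hβ.pow_eq_one] at h
    -- Coprimality of c' and L is what keeps distinct residues a at distinct evaluation points
    -- β^{c'a}.
    have h2 : a ≡ q ^ t [MOD L] := Nat.ModEq.cancel_left_of_coprime hc'
      (hβ.pow_inj (Nat.mod_lt _ hL) (Nat.mod_lt _ hL) h)
    apply ha t (Finset.mem_range.1 ht)
    simpa using (ZMod.natCast_eq_natCast_iff _ _ _).2 h2

end Separation


theorem kronecker_mul_blockPsi_mul_kronecker_apply {q L k n J : ℕ} (l : Fin n → ℕ)
    (P : Matrix (Fin J) (Fin L) (ZMod q)) (Q : Matrix (Fin L) (Fin J) (ZMod q))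
    (s : Fin k) (i : Fin n) (r r' : Fin J) :
    (((1 : Matrix (Fin k) (Fin k) (ZMod q)) ⊗ₖ P) * blockPsi q L k l *
        ((1 : Matrix (Fin n) (Fin n) (ZMod q)) ⊗ₖ Q)) (s, r) (i, r') =
      (P * cyclicMatrix (ZMod q) L ^ (q ^ (s : ℕ) * l i) * Q) r r' := by
  simp [Matrix.mul_apply, Fintype.sum_prod_type, blockPsi, Matrix.one_apply]

theorem card_coprimeIdx (L : ℕ) : Fintype.card (CoprimeIdx L) = L.totient := by
  rw [Fintype.card_subtype, Nat.totient_eq_card_coprime]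
  refine Finset.card_bij (fun x _ => (x : ℕ)) ?_ (fun _ _ _ _ h => Fin.ext h) ?_
  · intro a ha
    simpa [Nat.coprime_comm] using ha
  · intro a ha
    rw [Finset.mem_filter, Finset.mem_range] at ha
    exact ⟨⟨a, ha.1⟩, by simpa [Nat.coprime_comm] using ha.2, rfl⟩

/-! ### Matrices that stabilize a circular-shift code. -/

section Stabilizer

variable {q L k n : ℕ} {E : Type*} [Field E] [Algebra (ZMod q) E] {β : E}
  {P : Matrix (Fin L.totient) (Fin L) (ZMod q)} {Q : Matrix (Fin L) (Fin L.totient) (ZMod q)}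
  {A A' Z : Matrix (Fin L.totient) (CoprimeIdx L) E} {W : Matrix (CoprimeIdx L) (Fin L.totient) E}

/-- The image of a codeword under a linear functional on the columns, in diagonalized form. -/
theorem sum_mul_codeword (l : Fin n → ℕ)
    (hPQ : ∀ t r r', algebraMap (ZMod q) E ((P * cyclicMatrix (ZMod q) L ^ t * Q) r r') =
      ∑ j : CoprimeIdx L, A r j * β ^ ((j : ℕ) * t) * W j r')
    (m : Fin k × Fin L.totient → ZMod q) (ρ : Fin L.totient → E) (i : Fin n) :
    ∑ r', ρ r' * algebraMap (ZMod q) E (blocksToColumns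
      (m ᵥ* (((1 : Matrix (Fin k) (Fin k) (ZMod q)) ⊗ₖ P) * blockPsi q L k l *
        ((1 : Matrix (Fin n) (Fin n) (ZMod q)) ⊗ₖ Q))) r' i) =
      ∑ j, (W *ᵥ ρ) j * ∑ s : Fin k, (∑ r, algebraMap (ZMod q) E (m (s, r)) * A r j) *
        β ^ ((j : ℕ) * (q ^ (s : ℕ) * l i)) := by
  simp only [blocksToColumns, Matrix.of_apply, Matrix.vecMul, dotProduct, Fintype.sum_prod_type,
    kronecker_mul_blockPsi_mul_kronecker_apply, map_sum, map_mul, hPQ, Matrix.mulVec,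
    Finset.mul_sum, Finset.sum_mul]
  have h1 : ∀ F : Fin L.totient → Fin k → Fin L.totient → CoprimeIdx L → E,
      ∑ x, ∑ s, ∑ r, ∑ j, F x s r j = ∑ j, ∑ s, ∑ r, ∑ x, F x s r j := by
    intro F
    rw [Finset.sum_comm, Finset.sum_comm (s := (Finset.univ : Finset (CoprimeIdx L)))]
    refine Finset.sum_congr rfl fun s _ => ?_
    rw [Finset.sum_comm, Finset.sum_comm (s := (Finset.univ : Finset (CoprimeIdx L)))]
    refine Finset.sum_congr rfl fun r _ => ?_
    rw [Finset.sum_comm]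
  rw [h1]
  refine Finset.sum_congr rfl fun j _ => Finset.sum_congr rfl fun s _ =>
    Finset.sum_congr rfl fun r _ => Finset.sum_congr rfl fun x _ => ?_
  ring

/-- Over `E`, the matrices that stabilize a circular-shift code have the row of `Z` with index
`1` as a common left eigenvector. -/
theorem exists_eigenvalue (hL : 0 < L) (hk : 0 < k) (hkn : k < n)
    (hn : n ≤ orderOf (q : ZMod L)) (hβ : IsPrimitiveRoot β L)
    {l : Fin n → ℕ} {c c' : ℕ} (hl : ∀ j : Fin n, l j = (c' * (j : ℕ) + c) % L)
    (hc' : Nat.Coprime L c')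
    (hPQ : ∀ t r r', algebraMap (ZMod q) E ((P * cyclicMatrix (ZMod q) L ^ t * Q) r r') =
      ∑ j : CoprimeIdx L, A r j * β ^ ((j : ℕ) * t) * W j r')
    (hA : A'ᵀ * A = 1) (hZ : W * Z = 1)
    {j₀ : CoprimeIdx L} (hj₀ : (j₀ : ℕ) = 1)
    {X : Matrix (Fin L.totient) (Fin L.totient) (ZMod q)}
    (hX : ∀ M ∈ circularShiftCode q L k l P Q, X * M ∈ circularShiftCode q L k l P Q) :
    ∃ y : E, (fun r => Z r j₀) ᵥ* X.map (algebraMap (ZMod q) E) = y • fun r => Z r j₀ := by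
  obtain ⟨f, hf0, hf1⟩ := exists_functional (q := q) hL hβ hkn hl hc'
  set ρ : Fin L.totient → E := (fun r => Z r j₀) ᵥ* X.map (algebraMap (ZMod q) E) with hρ
  have hZ' : Z * W = 1 :=
    (Matrix.mul_eq_one_comm_of_card_eq _ _ _ (by
      rw [card_coprimeIdx, Fintype.card_fin])).1 hZ
  have hWZ : W *ᵥ (fun r => Z r j₀) = Pi.single j₀ 1 := by
    ext j
    have := congrFun (congrFun hZ j) j₀
    rw [Matrix.mul_apply, Matrix.one_apply] at this
    rw [Matrix.mulVec, dotProduct, this, Pi.single_apply]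
  -- Compute z(XM) in two ways: through ρ = zX acting on M, and through z acting on the codeword XM.
  -- The second lies in the span that f annihilates.
  have hsum : ∀ m : Fin k × Fin L.totient → ZMod q,
      ∑ j, (W *ᵥ ρ) j * ∑ s : Fin k, (∑ r, algebraMap (ZMod q) E (m (s, r)) * A r j) *
        ∑ i, f i * β ^ ((j : ℕ) * q ^ (s : ℕ) * l i) = 0 := by
    intro m
    obtain ⟨m', hm'⟩ := hX _ ⟨m, rfl⟩
    have hrow : ∀ i, ∑ j, (W *ᵥ ρ) j * ∑ s : Fin k,
        (∑ r, algebraMap (ZMod q) E (m (s, r)) * A r j) *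
          β ^ ((j : ℕ) * (q ^ (s : ℕ) * l i)) =
        ∑ s : Fin k, (∑ r, algebraMap (ZMod q) E (m' (s, r)) * A r j₀) *
          β ^ (q ^ (s : ℕ) * l i) := by
      intro i
      have h2 := sum_mul_codeword l hPQ m' (fun r => Z r j₀) i
      rw [hWZ, ← hm'] at h2
      simp only [Pi.single_apply, ite_mul, one_mul, zero_mul, Finset.sum_ite_eq',
        Finset.mem_univ, if_true, hj₀] at h2
      rw [← h2, ← sum_mul_codeword l hPQ m ρ i]
      simp only [hρ, Matrix.vecMul, dotProduct, Matrix.mul_apply, Matrix.map_apply, map_sum,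
        map_mul, Finset.mul_sum, Finset.sum_mul, mul_assoc]
      exact Finset.sum_comm
    have h3 : ∑ i, f i * ∑ s : Fin k, (∑ r, algebraMap (ZMod q) E (m' (s, r)) * A r j₀) *
          β ^ (q ^ (s : ℕ) * l i) = 0 := by
      simp_rw [Finset.mul_sum]
      rw [Finset.sum_comm]
      refine Finset.sum_eq_zero fun s _ => ?_
      rw [← mul_zero (∑ r, algebraMap (ZMod q) E (m' (s, r)) * A r j₀), ← hf0 s s.2,
        Finset.mul_sum]
      exact Finset.sum_congr rfl fun i _ => by ring
    simp_rw [← hrow] at h3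
    rw [← h3]
    simp_rw [Finset.mul_sum (s := (Finset.univ : Finset (CoprimeIdx L)))]
    rw [Finset.sum_comm]
    refine Finset.sum_congr rfl fun j _ => ?_
    simp_rw [Finset.mul_sum (s := (Finset.univ : Finset (Fin n))),
      Finset.mul_sum (s := (Finset.univ : Finset (Fin k)))]
    rw [Finset.sum_comm]
    simp_rw [Finset.mul_sum (s := (Finset.univ : Finset (Fin n)))]
    exact Finset.sum_congr rfl fun i _ => Finset.sum_congr rfl fun s _ => by
      rw [mul_assoc (j : ℕ)]
      ring
  have hoff : ∀ j, j ≠ j₀ → (W *ᵥ ρ) j = 0 := by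
    intro j hj
    have hj1 : ((j : ℕ) : ZMod L) ≠ 1 := by
      intro h
      apply hj
      rw [← Nat.cast_one, ZMod.natCast_eq_natCast_iff, ← hj₀] at h
      exact Subtype.ext (Fin.ext (Nat.ModEq.eq_of_lt_of_lt h j.1.2 j₀.1.2))
    obtain ⟨s, hs, hst⟩ := exists_mul_pow_ne_pow hk (hkn.trans_le hn) hj1
    -- Unit messages supported in block s isolate that s and one row of A at a time; inverting A
    -- then makes each j-term vanish separately.
    have hv : A *ᵥ (fun j : CoprimeIdx L =>
        (W *ᵥ ρ) j * ∑ i, f i * β ^ ((j : ℕ) * q ^ s * l i)) = 0 := by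
      ext r
      have h4 := hsum (Pi.single (⟨s, hs⟩, r) 1)
      rw [Pi.zero_apply, ← h4, Matrix.mulVec, dotProduct]
      refine Finset.sum_congr rfl fun j _ => ?_
      rw [Finset.sum_eq_single (⟨s, hs⟩ : Fin k), Finset.sum_eq_single r]
      · simp
        ring
      · intro b _ hb
        simp [hb]
      · simp
      · intro b _ hb
        simp [hb]
      · simp
    have hv' := congrArg (fun v => A'ᵀ *ᵥ v) hv
    simp only [Matrix.mulVec_mulVec, hA, Matrix.one_mulVec, Matrix.mulVec_zero] at hv'
    have h5 := congrFun hv' j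
    refine (mul_eq_zero.1 h5).resolve_right (hf1 _ fun t ht => ?_)
    simpa using hst t ht
  refine ⟨(W *ᵥ ρ) j₀, ?_⟩
  have h6 : W *ᵥ ρ = (W *ᵥ ρ) j₀ • Pi.single j₀ 1 := by
    ext j
    by_cases hj : j = j₀
    · subst hj
      simp
    · simp [hoff j hj, hj]
  rw [← hWZ, ← Matrix.mulVec_smul] at h6
  have h7 := congrArg (fun v => Z *ᵥ v) h6
  simpa only [Matrix.mulVec_mulVec, hZ', Matrix.one_mulVec] using h7

/-- A field extension `K` of `𝔽_q` of degree `φ(L)` acting on a circular-shift code by left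
multiplication embeds into `E`. -/
theorem totient_le_finrank_of_stabilizer [Module.Finite (ZMod q) E] [Fact q.Prime]
    (hL : 0 < L) (hk : 0 < k) (hkn : k < n)
    (hn : n ≤ orderOf (q : ZMod L)) (hβ : IsPrimitiveRoot β L)
    {l : Fin n → ℕ} {c c' : ℕ} (hl : ∀ j : Fin n, l j = (c' * (j : ℕ) + c) % L)
    (hc' : Nat.Coprime L c')
    (hPQ : ∀ t r r', algebraMap (ZMod q) E ((P * cyclicMatrix (ZMod q) L ^ t * Q) r r') =
      ∑ j : CoprimeIdx L, A r j * β ^ ((j : ℕ) * t) * W j r')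
    (hA : A'ᵀ * A = 1) (hZ : W * Z = 1)
    {j₀ : CoprimeIdx L} (hj₀ : (j₀ : ℕ) = 1)
    {K : Type*} [Field K] [Algebra (ZMod q) K]
    (φ : K →ₐ[ZMod q] Matrix (Fin L.totient) (Fin L.totient) (ZMod q))
    (hφ : ∀ κ, ∀ M ∈ circularShiftCode q L k l P Q, φ κ * M ∈ circularShiftCode q L k l P Q) :
    Module.finrank (ZMod q) K ≤ Module.finrank (ZMod q) E := by
  set z : Fin L.totient → E := fun r => Z r j₀ with hz
  have hz0 : ∃ r, z r ≠ 0 := by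
    by_contra! h
    have := congrFun (congrFun hZ j₀) j₀
    rw [Matrix.mul_apply, Matrix.one_apply_eq] at this
    rw [Finset.sum_eq_zero fun r _ => by rw [show Z r j₀ = 0 from h r, mul_zero]] at this
    exact zero_ne_one this
  obtain ⟨r, hr⟩ := hz0
  -- The vector z is nonzero, so the eigenvalue is unique and inherits the algebra operations of K.
  choose y hy using fun κ => exists_eigenvalue hL hk hkn hn hβ hl hc' hPQ hA hZ hj₀ (hφ κ)
  have huniq : ∀ {a b : E}, a • z = b • z → a = b := fun {a b} h =>
    mul_right_cancel₀ hr (congrFun h r)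
  let ψ : K →ₗ[ZMod q] E :=
    { toFun := y
      map_add' := fun a b => huniq (by
        rw [← hy, map_add, Matrix.map_add _ (map_add _), Matrix.vecMul_add, hy, hy, add_smul])
      map_smul' := fun a b => huniq (by
        rw [← hy, map_smul, RingHom.id_apply, smul_assoc, ← hy]
        ext i
        simp only [Matrix.vecMul, dotProduct, Matrix.map_apply, Matrix.smul_apply, smul_eq_mul,
          map_mul, Pi.smul_apply, Algebra.smul_def a (_ : E), Finset.mul_sum]
        exact Finset.sum_congr rfl fun _ _ => by ring) }
  refine LinearMap.finrank_le_finrank_of_injective (f := ψ) ?_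
  rw [injective_iff_map_eq_zero]
  intro a ha
  by_contra ha0
  -- As y is multiplicative and y 1 = 1, a nonzero a with y a = 0 would give 1 = 0.
  have h1 : y (a * a⁻¹) = y a * y a⁻¹ := huniq (by
    rw [← hy, map_mul, Matrix.map_mul, ← Matrix.vecMul_vecMul, hy, Matrix.smul_vecMul, hy,
      smul_smul])
  have h2 : y 1 = 1 := huniq (by
    rw [← hy, map_one, Matrix.map_one _ (map_zero _) (map_one _), Matrix.vecMul_one, one_smul])
  rw [mul_inv_cancel₀ ha0, h2, show y a = 0 from ha, zero_mul] at h1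
  exact one_ne_zero h1

end Stabilizer

/-! ### Scalar closure of twisted Gabidulin codes. -/

section TwistedGabidulin

/-- For `h = 0`, a twisted Gabidulin code is closed under scalar multiplication. -/
theorem smul_mem_twistedGabidulin {K : Type*} [Field K] (q : ℕ) {k n : ℕ} (hk : 0 < k) (η : K)
    (b : Fin n → K) (κ : K) {v : Fin n → K} (hv : v ∈ twistedGabidulin q hk 0 η b) :
    κ • v ∈ twistedGabidulin q hk 0 η b := by
  obtain ⟨p, ⟨u, rfl⟩, rfl⟩ := hv
  refine ⟨_, ⟨κ • u, rfl⟩, ?_⟩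
  ext j
  simp only [Pi.smul_apply, smul_eq_mul, eval_add, eval_finsetSum, eval_mul, eval_C, eval_pow,
    eval_X, pow_zero, pow_one, mul_add, Finset.mul_sum]
  congr 1
  · exact Finset.sum_congr rfl fun _ _ => by ring
  · ring

theorem leftMulMatrix_mul_mem_matrixCode {q N n : ℕ} {K : Type*} [Field K] [Algebra (ZMod q) K]
    (B : Module.Basis (Fin N) (ZMod q) K) {S : Set (Fin n → K)}
    {κ : K} (hS : ∀ v ∈ S, κ • v ∈ S) {M : Matrix (Fin N) (Fin n) (ZMod q)}
    (hM : M ∈ matrixCode B S) : Algebra.leftMulMatrix B κ * M ∈ matrixCode B S := by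
  obtain ⟨v, hv, rfl⟩ := hM
  refine ⟨_, hS v hv, ?_⟩
  ext i j
  have := congrFun (Algebra.leftMulMatrix_mulVec_repr B κ (v j)) i
  simpa [Matrix.mul_apply, Matrix.mulVec, dotProduct, Module.Basis.toMatrix_apply] using this

end TwistedGabidulin

theorem orderOf_natCast_le_totient {q L : ℕ} (hL : 0 < L) (h : Nat.Coprime q L) :
    orderOf (q : ZMod L) ≤ L.totient := by
  have : NeZero L := ⟨hL.ne'⟩
  rw [← ZMod.coe_unitOfCoprime q h, orderOf_units, ← ZMod.card_units_eq_totient]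
  exact orderOf_le_card_univ


/-! ### Diagonalization of the two concrete codes. -/

section GHPair

variable {q L : ℕ} {E : Type*} [Field E] [Algebra (ZMod q) E] {β : E}

theorem eval_tau_eq_zero_iff (hL : 0 < L) (hβ : IsPrimitiveRoot β L) (j : Fin L) :
    ((tau q L).map (algebraMap (ZMod q) E)).eval (β ^ (j : ℕ)) = 0 ↔ ¬ Nat.Coprime (j : ℕ) L := by
  rw [tau_map hL hβ, eval_prod, Finset.prod_eq_zero_iff]
  constructor
  · rintro ⟨a, ha, h⟩
    rw [Finset.mem_filter, Finset.mem_range] at ha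
    rw [eval_sub, eval_X, eval_C, sub_eq_zero] at h
    rw [hβ.pow_inj j.2 ha.1 h]
    exact ha.2
  · intro h
    exact ⟨j, Finset.mem_filter.2 ⟨Finset.mem_range.2 j.2, h⟩, by simp⟩

theorem sum_eq_sum_coprimeIdx {M : Type*} [AddCommMonoid M] {F : Fin L → M}
    (hF : ∀ j : Fin L, ¬ Nat.Coprime (j : ℕ) L → F j = 0) :
    ∑ j, F j = ∑ j : CoprimeIdx L, F j := by
  rw [← Finset.sum_filter_of_ne (p := fun j : Fin L => Nat.Coprime (j : ℕ) L)
    fun j _ h => not_not.1 fun h' => h (hF j h')]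
  exact Finset.sum_subtype _ (by simp) _

theorem coprime_val_neg [NeZero L] {j : Fin L} (h : Nat.Coprime (j : ℕ) L) :
    Nat.Coprime ((-j : Fin L) : ℕ) L := by
  rw [Fin.val_neg', Nat.Coprime, ← Nat.gcd_rec, Nat.gcd_comm]
  exact (Nat.coprime_self_sub_left j.2.le).2 h

theorem map_mul_pow_mul {J : Type*} (P : Matrix J (Fin L) (ZMod q))
    (Q : Matrix (Fin L) J (ZMod q)) (t : ℕ) (r r' : J) :
    algebraMap (ZMod q) E ((P * cyclicMatrix (ZMod q) L ^ t * Q) r r') =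
      (P.map (algebraMap (ZMod q) E) * cyclicMatrix E L ^ t * Q.map (algebraMap (ZMod q) E)) r r' := by
  rw [← cyclicMatrix_map (algebraMap (ZMod q) E), ← Matrix.map_pow, ← Matrix.map_mul,
    ← Matrix.map_mul, Matrix.map_apply]

theorem aeval_cyclicMatrix_map (p : (ZMod q)[X]) :
    (aeval (cyclicMatrix (ZMod q) L) p).map (algebraMap (ZMod q) E) =
      aeval (cyclicMatrix E L) (p.map (algebraMap (ZMod q) E)) := by
  rw [← cyclicMatrix_map (algebraMap (ZMod q) E), aeval_map_algebraMap]
  exact (aeval_algHom_apply (Algebra.ofId (ZMod q) E).mapMatrix _ p).symm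

variable {G : Matrix (Fin L.totient) (Fin L) (ZMod q)} {H : Matrix (Fin L) (Fin L.totient) (ZMod q)}

/-- The indices not coprime to L drop out because U or U' vanishes there; on the others L U'ᵀ
inverts U. -/
theorem IsGHPair.exists_diagonalization (hL : 0 < L) (hβ : IsPrimitiveRoot β L)
    (h : IsGHPair β G H) :
    ∃ (A A' Z : Matrix (Fin L.totient) (CoprimeIdx L) E)
      (W : Matrix (CoprimeIdx L) (Fin L.totient) E),
      (∀ t r r', algebraMap (ZMod q) E ((G * cyclicMatrix (ZMod q) L ^ t * H) r r') =
        ∑ j : CoprimeIdx L, A r j * β ^ ((j : ℕ) * t) * W j r') ∧ A'ᵀ * A = 1 ∧ W * Z = 1 := by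
  have : NeZero L := ⟨hL.ne'⟩
  have hL0 : (L : E) ≠ 0 := hβ.neZero'.ne
  obtain ⟨U, U', -, hUU', h0, hG, hH⟩ := h
  refine ⟨coprimeCols U, (L : E) • coprimeCols U', coprimeCols U, (L : E) • (coprimeCols U')ᵀ,
    fun t r r' => ?_, ?_, ?_⟩
  · have h1 := mul_aeval_cyclicMatrix_mul hL hβ U U' (X ^ t) r r'
    rw [map_pow, aeval_X] at h1
    rw [map_mul_pow_mul, hG, hH, h1, sum_eq_sum_coprimeIdx]
    · simp [coprimeCols, pow_mul]
    · intro j hj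
      rcases h0 with h0 | h0 <;> simp [h0 _ j hj]
  · rw [Matrix.transpose_smul, Matrix.smul_mul, hUU', smul_smul, mul_inv_cancel₀ hL0, one_smul]
  · rw [Matrix.smul_mul, hUU', smul_smul, mul_inv_cancel₀ hL0, one_smul]

/-- Here τ(C_L) does the work of the vanishing condition: τ(β^j) is zero exactly when j is not
coprime to L. Transposing G replaces β by β⁻¹, so W involves the columns of U at -j, and its inverse
comes from those of U' at -j. -/
theorem IsGHPair.exists_diagonalization_tau (hL : 0 < L) (hβ : IsPrimitiveRoot β L)
    (h : IsGHPair β G H) :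
    ∃ (A A' Z : Matrix (Fin L.totient) (CoprimeIdx L) E)
      (W : Matrix (CoprimeIdx L) (Fin L.totient) E),
      (∀ t r r', algebraMap (ZMod q) E ((G * cyclicMatrix (ZMod q) L ^ t *
          (aeval (cyclicMatrix (ZMod q) L) (tau q L) * Gᵀ)) r r') =
        ∑ j : CoprimeIdx L, A r j * β ^ ((j : ℕ) * t) * W j r') ∧ A'ᵀ * A = 1 ∧ W * Z = 1 := by
  have : NeZero L := ⟨hL.ne'⟩
  have hL0 : (L : E) ≠ 0 := hβ.neZero'.ne
  obtain ⟨U, U', -, hUU', -, hG, -⟩ := h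
  set τ : E[X] := (tau q L).map (algebraMap (ZMod q) E)
  have hGT : Gᵀ.map (algebraMap (ZMod q) E) =
      vandermondeL L β * (U.submatrix id (fun j : Fin L => -j))ᵀ := by
    rw [Matrix.transpose_map, hG, Matrix.transpose_mul]
    have hsymm : (vandermondeL L β⁻¹)ᵀ = vandermondeL L β⁻¹ := by
      ext i j
      simp [vandermondeL, mul_comm]
    rw [hsymm, vandermondeL_inv hβ]
    ext i r
    simp only [Matrix.mul_apply, Matrix.submatrix_apply, Matrix.transpose_apply, id]
    exact Fintype.sum_equiv (Equiv.neg _) _ _ fun j => by simp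
  refine ⟨coprimeCols U, (L : E) • coprimeCols U',
    Matrix.of fun r j => (τ.eval (β ^ (j : ℕ)))⁻¹ * U' r (-(j : Fin L)),
    Matrix.of fun j r => τ.eval (β ^ (j : ℕ)) * ((L : E) * U r (-(j : Fin L))),
    fun t r r' => ?_, ?_, ?_⟩
  · have h1 := mul_aeval_cyclicMatrix_mul hL hβ U (U.submatrix id (fun j : Fin L => -j))
      (X ^ t * τ) r r'
    rw [map_mul, map_pow, aeval_X] at h1
    rw [map_mul_pow_mul, Matrix.map_mul, aeval_cyclicMatrix_map, hGT, hG, ← Matrix.mul_assoc,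
      Matrix.mul_assoc (U * vandermondeL L β⁻¹), h1, sum_eq_sum_coprimeIdx]
    · simp [coprimeCols, pow_mul, mul_assoc]
    · intro j hj
      rw [eval_mul, (eval_tau_eq_zero_iff hL hβ j).2 hj]
      simp
  · rw [Matrix.transpose_smul, Matrix.smul_mul, hUU', smul_smul, mul_inv_cancel₀ hL0, one_smul]
  · ext j j'
    have h2 := congrFun (congrFun hUU' ⟨-(j' : Fin L), coprime_val_neg j'.2⟩)
      ⟨-(j : Fin L), coprime_val_neg j.2⟩
    simp only [Matrix.mul_apply, Matrix.transpose_apply, coprimeCols, Matrix.submatrix_apply, id,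
      Matrix.smul_apply, Matrix.one_apply, Subtype.mk.injEq, neg_inj, smul_eq_mul] at h2
    have h3 : ∑ r, τ.eval (β ^ (j : ℕ)) * ((L : E) * U r (-(j : Fin L))) *
        ((τ.eval (β ^ (j' : ℕ)))⁻¹ * U' r (-(j' : Fin L))) =
        τ.eval (β ^ (j : ℕ)) * (τ.eval (β ^ (j' : ℕ)))⁻¹ * L *
          ∑ r, U' r (-(j' : Fin L)) * U r (-(j : Fin L)) := by
      rw [Finset.mul_sum]
      exact Finset.sum_congr rfl fun r _ => by ring
    have hτ0 : τ.eval (β ^ (j : ℕ)) ≠ 0 := fun h =>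
      (eval_tau_eq_zero_iff hL hβ j.1).1 h j.2
    simp only [Matrix.mul_apply, Matrix.of_apply, Matrix.one_apply]
    rw [h3, h2]
    by_cases hj : j = j'
    · subst hj
      simp only [if_true]
      field_simp
    · rw [if_neg (fun h => hj (Subtype.ext h.symm)), if_neg hj]
      simp

end GHPair

/-- If a circular-shift code is diagonalized over `E`, and `φ(L)` exceeds the degree of `E`, then
it is not a twisted Gabidulin code with `h = 0`. -/
theorem circularShiftCode_ne_twistedGabidulin {q L k n : ℕ} [Fact q.Prime] {E : Type*} [Field E]
    [Algebra (ZMod q) E] [Module.Finite (ZMod q) E] {β : E}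
    {P : Matrix (Fin L.totient) (Fin L) (ZMod q)} {Q : Matrix (Fin L) (Fin L.totient) (ZMod q)}
    (hL : 1 < L) (hk : 0 < k) (hkn : k < n) (hn : n ≤ orderOf (q : ZMod L))
    (hJ : Module.finrank (ZMod q) E < L.totient) (hβ : IsPrimitiveRoot β L)
    {l : Fin n → ℕ} {c c' : ℕ} (hl : ∀ j : Fin n, l j = (c' * (j : ℕ) + c) % L)
    (hc' : Nat.Coprime L c')
    (hPQ : ∃ (A A' Z : Matrix (Fin L.totient) (CoprimeIdx L) E)
      (W : Matrix (CoprimeIdx L) (Fin L.totient) E),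
      (∀ t r r', algebraMap (ZMod q) E ((P * cyclicMatrix (ZMod q) L ^ t * Q) r r') =
        ∑ j : CoprimeIdx L, A r j * β ^ ((j : ℕ) * t) * W j r') ∧ A'ᵀ * A = 1 ∧ W * Z = 1)
    {K : Type*} [Field K] [Algebra (ZMod q) K]
    (B : Module.Basis (Fin L.totient) (ZMod q) K) (b : Fin n → K) (η : K) :
    circularShiftCode q L k l P Q ≠ matrixCode B (twistedGabidulin q hk 0 η b) := by
  intro heq
  obtain ⟨A, A', Z, W, hPQ, hA, hZ⟩ := hPQ
  have h := totient_le_finrank_of_stabilizer (zero_lt_one.trans hL) hk hkn hn hβ hl hc' hPQ hA hZ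
    (j₀ := ⟨⟨1, hL⟩, Nat.coprime_one_left L⟩) rfl (Algebra.leftMulMatrix B) fun κ M hM => by
      rw [heq] at hM ⊢
      exact leftMulMatrix_mul_mem_matrixCode B
        (fun v hv => smul_mem_twistedGabidulin q hk η b κ hv) hM
  rw [Module.finrank_eq_card_basis B, Fintype.card_fin] at h
  omega

end CircShift

theorem proposition4 (q : ℕ) [Fact q.Prime] (L : ℕ) (hqL : Nat.Coprime q L)
    (k n : ℕ) (hk : 0 < k) (hkn : k < n) (hn : n ≤ orderOf (q : ZMod L))
    (hJ : L.totient ≠ orderOf (q : ZMod L))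
    -- the field with `q ^ m_L` elements and a primitive `L`-th root of unity in it
    {E : Type*} [Field E] [Algebra (ZMod q) E]
    (hE : Module.finrank (ZMod q) E = orderOf (q : ZMod L))
    (β : E) (hβ : IsPrimitiveRoot β L)
    -- the matrices `G_L` and `H_L`
    (G : Matrix (Fin L.totient) (Fin L) (ZMod q)) (H : Matrix (Fin L) (Fin L.totient) (ZMod q))
    (hGH : CircShift.IsGHPair β G H)
    -- the exponents `l_j`
    (l : Fin n → ℕ) (c c' : ℕ) (hc : c ≤ L - 1) (hc1 : 1 ≤ c') (hc2 : c' ≤ L - 1)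
    (hl : ∀ j : Fin n, l j = (c' * (j : ℕ) + c) % L)
    (hcop : Nat.Coprime (∑ j ∈ Finset.range k, c' * q ^ j) L)
    -- an arbitrary twisted Gabidulin code with `h = 0` over the field with `q ^ J` elements
    {K : Type*} [Field K] [Algebra (ZMod q) K]
    (B : Module.Basis (Fin L.totient) (ZMod q) K)
    (b : Fin n → K) (hb : LinearIndependent (ZMod q) b) (η : K) :
    CircShift.codeC1 q L k l G H ≠
        CircShift.matrixCode B (CircShift.twistedGabidulin q hk 0 η b) ∧
      CircShift.codeC2 q L k l G ≠
        CircShift.matrixCode B (CircShift.twistedGabidulin q hk 0 η b) := by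
  have hL : 1 < L := by omega
  -- The sum factors as c' · Σ q^j, and only its factor c' matters here.
  have hc' : Nat.Coprime L c' := by
    rw [← Finset.mul_sum] at hcop
    exact hcop.coprime_mul_right.symm
  have hfin : 0 < Module.finrank (ZMod q) E := by omega
  -- `Module.finrank` is 0 for an infinite extension, so its positivity gives finiteness.
  have : Module.Finite (ZMod q) E := Module.finite_of_finrank_pos hfin
  have hlt : Module.finrank (ZMod q) E < L.totient := by
    have := CircShift.orderOf_natCast_le_totient (zero_lt_one.trans hL) hqL
    omega
  exact ⟨CircShift.circularShiftCode_ne_twistedGabidulin hL hk hkn hn hlt hβ hl hc'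
      (hGH.exists_diagonalization (zero_lt_one.trans hL) hβ) B b η,
    CircShift.circularShiftCode_ne_twistedGabidulin hL hk hkn hn hlt hβ hl hc'
      (hGH.exists_diagonalization_tau (zero_lt_one.trans hL) hβ) B b η⟩
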